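/- Let $d\ge 2$ be an integer and let $R$ be a random variable with values in $[0,\infty)$ whose distribution is absolutely continuous and satisfies $\lim_{h\to\infty}h^{s}\,\mathbb{P}(R>h)=\beta$ for some $\beta\in(0,\infty)$ and some $s\ge d$. For $n>0$ let $\mathbb{T}_n$ be the $d$-dimensional torus of side length $n$, i.e. the cube $[-n/2,n/2]^d$ with opposite faces identified, and write $B^{\mathbb{T}_n}_r(\xi)$ for the closed ball of radius $r$ around $\xi$ in the toroidal (Euclidean) distance. Let $X^{(n)}$ be a homogeneous Poisson point process on $\mathbb{T}_n$ with intensity $1$ whose points carry independent marks distributed as $R$; thus $X^{(n)}$ is a random finite subset of $\mathbb{T}_n\times[0,\infty)$. For a finite set $\varphi\subset\mathbb{T}_n\times[0,\infty)$ let $G(\varphi)$ be the graph on $\varphi$ with an edge from $(\xi,r)$ to $(\eta,t)$ if $\eta\in B^{\mathbb{T}_n}_r(\xi)$, and let $G'(\varphi)$ be the graph on $\varphi$ with an edge from $(\xi,r)$ to $(\eta,t)$ if $\eta\in B^{\mathbb{T}_n}_r(\xi)$, $t<r$, and there is no $(\zeta,w)\in\varphi$ with $\zeta\in B^{\mathbb{T}_n}_r(\xi)$,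 $t<w<r$ and $\eta\in B^{\mathbb{T}_n}_w(\zeta)$. In both graphs edges may be traversed in both directions. Then there exists a constant $c_1>0$, depending only on $d$ and the distribution of $R$, such that with probability tending to $1$ as $n\to\infty$ the following holds: any two distinct $x,y\in X^{(n)}$ that are adjacent in $G(X^{(n)})$ can be connected by a path in $G'(X^{(n)})$ consisting of at most $c_1\log n$ hops. -/

import Mathlib

open MeasureTheory ProbabilityTheory Filter Topology

namespace ScaleFreeGilbert

/-- The `d`-dimensional torus with side length `n`, that is, the cube `[-n/2, n/2]^d` with
opposite faces identified: the product of `d` circles of circumference `n`. Its `volume` is the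
product Lebesgue measure, of total mass `n ^ d`. -/
abbrev Torus (d : ℕ) (n : ℝ) : Type := Fin d → AddCircle n

/-- The toroidal distance: the Euclidean combination of the coordinatewise circle distances
(the instance `Dist` on the product type would be the sup distance). -/
noncomputable def torusDist {d : ℕ} {n : ℝ} (ξ η : Torus d n) : ℝ :=
  √(∑ i, dist (ξ i) (η i) ^ 2)

/-- The closed ball in the torus for the toroidal distance. -/
def torusBall {d : ℕ} {n : ℝ} (ξ : Torus d n) (r : ℝ) : Set (Torus d n) :=
  {η | torusDist ξ η ≤ r}

/-- A marked point: a location on the torus together with its mark (a radius). -/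
abbrev MarkedPoint (d : ℕ) (n : ℝ) : Type := Torus d n × ℝ

/-- The directed edge relation of the scale-free Gilbert graph: an edge goes from `(ξ, r)` to
`(η, t)` if `η` lies in the ball of radius `r` around `ξ`. -/
def GilbertEdge {d : ℕ} {n : ℝ} (x y : MarkedPoint d n) : Prop :=
  y.1 ∈ torusBall x.1 x.2

/-- The directed edge relation of the thinned scale-free Gilbert graph on `φ`: an edge goes from
`(ξ, r)` to `(η, t)` if `t < r`, `η` lies in the ball of radius `r` around `ξ`, and there is no
`(ζ, w)` in `φ` with `t < w < r`, with `ζ` in the ball of radius `r` around `ξ`, and with `η` in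
the ball of radius `w` around `ζ`. -/
def ThinnedEdge {d : ℕ} {n : ℝ} (φ : Finset (MarkedPoint d n)) (x y : MarkedPoint d n) : Prop :=
  y.1 ∈ torusBall x.1 x.2 ∧ y.2 < x.2 ∧
    ¬ ∃ z ∈ φ, z.1 ∈ torusBall x.1 x.2 ∧ y.2 < z.2 ∧ z.2 < x.2 ∧ y.1 ∈ torusBall z.1 z.2

/-- The scale-free Gilbert graph on `φ`, where edges may be traversed in both directions. -/
def gilbertGraph {d : ℕ} {n : ℝ} (φ : Finset (MarkedPoint d n)) : SimpleGraph {x // x ∈ φ} :=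
  SimpleGraph.fromRel fun x y => GilbertEdge x.1 y.1

/-- The thinned scale-free Gilbert graph on `φ`, where edges may be traversed in both
directions. -/
def thinnedGraph {d : ℕ} {n : ℝ} (φ : Finset (MarkedPoint d n)) : SimpleGraph {x // x ∈ φ} :=
  SimpleGraph.fromRel fun x y => ThinnedEdge φ x.1 y.1

/-- The number of points of the finite configuration `φ` in `B`. -/
noncomputable def pointCount {S : Type*} (φ : Finset S) (B : Set S) : ℕ :=
  ((φ : Set S) ∩ B).ncard

/-- The random finite set `X`, defined on the probability space `(Ω, P)`, is a (simple) Poisson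
point process with finite intensity measure `μ`: the number of points in a measurable set `B` is
a Poisson random variable with mean `μ B`, and the numbers of points in pairwise disjoint
measurable sets are independent. -/
structure IsPoissonPointProcess {Ω S : Type*} [MeasurableSpace Ω] [MeasurableSpace S]
    (P : Measure Ω) (μ : Measure S) [IsFiniteMeasure μ] (X : Ω → Finset S) : Prop where
  measurable_count : ∀ B : Set S, MeasurableSet B → Measurable fun ω => pointCount (X ω) B
  map_count : ∀ B : Set S, MeasurableSet B →
    P.map (fun ω => pointCount (X ω) B) = poissonMeasure (μ B).toNNReal
  indep_count : ∀ (k : ℕ) (B : Fin k → Set S), (∀ i, MeasurableSet (B i)) →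
    Pairwise (fun i j => Disjoint (B i) (B j)) →
    iIndepFun (fun i ω => pointCount (X ω) (B i)) P

/-- `X` is an independently marked homogeneous Poisson point process with intensity `1` on the
torus of side length `n`, with mark distribution `ν`: a Poisson point process of marked points
whose intensity measure is the product of Lebesgue measure on the torus and `ν`. -/
def IsMarkedPoissonProcess {Ω : Type*} [MeasurableSpace Ω] {d : ℕ} {n : ℝ} [Fact (0 < n)]
    (P : Measure Ω) (ν : Measure ℝ) [IsProbabilityMeasure ν]
    (X : Ω → Finset (MarkedPoint d n)) : Prop :=
  IsPoissonPointProcess P ((volume : Measure (Torus d n)).prod ν) X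

/-- `ν` is an admissible radius distribution with tail parameters `β` and `s`: it is carried by
`[0, ∞)`, absolutely continuous, and `h ^ s * ν (h, ∞)` tends to `β` as `h → ∞`. -/
structure IsHeavyTailedRadiusLaw (ν : Measure ℝ) (β s : ℝ) : Prop where
  nonneg : ν (Set.Iio 0) = 0
  absolutelyContinuous : ν ≪ volume
  beta_pos : 0 < β
  s_pos : 0 < s
  tail : Tendsto (fun h : ℝ => h ^ s * ν.real (Set.Ioi h)) atTop (𝓝 β)

/-- Any two points of `φ` that are adjacent in the scale-free Gilbert graph on `φ` are joined by
a path with at most `ℓ` hops in the thinned scale-free Gilbert graph on `φ`. -/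
def ShortThinnedConnections {d : ℕ} {n : ℝ} (φ : Finset (MarkedPoint d n)) (ℓ : ℝ) : Prop :=
  ∀ x y : {x // x ∈ φ}, (gilbertGraph φ).Adj x y →
    ∃ p : (thinnedGraph φ).Walk x y, p.IsPath ∧ (p.length : ℝ) ≤ ℓ

end ScaleFreeGilbert

/-! A Gilbert edge towards a smaller mark that is missing from the thinned graph is blocked by a
point of intermediate mark, and splits into two Gilbert edges through it. Iterating gives a path of
thinned edges with strictly decreasing marks (`transGen_thinnedEdge`). If all marks are distinct, it
is therefore enough to exclude descending Gilbert chains with `k` edges, for some `k` of order `log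
n`.

Such chains are counted by a first-moment bound on a grid. Locations fall into cells of side about
one, marks into cells so fine that with high probability none is occupied twice
(`measureReal_not_isSeparated_le`). A descending chain then visits strictly decreasing mark cells.
The boxes visited are disjoint, so by independence all are occupied with probability at most the
product of their intensities.

Summing out the locations from the lower end of the chain leaves a factor `n ^ d` for the starting
cell and a ball volume for each hop. The sum over decreasing mark cells is then an elementary
symmetric function of the weights (ball volume times mark probability), at most `exp (-k + e W)` for
total weight `W` (`sum_strictAnti_prod_le`). Since `s ≥ d`, each dyadic scale contributes a bounded
amount to `W`. Marks above order `n ^ 2` are unlikely, so `W = O(log n)`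
(`sum_volume_mul_markCell_le`), and a large multiple of `log n` as `k` beats the factor `n ^ d`. -/

namespace ScaleFreeGilbert

/-! ### Deterministic reduction to descending chains -/

section Graph

variable {d : ℕ} {n : ℝ}

lemma torusDist_comm (ξ η : Torus d n) : torusDist ξ η = torusDist η ξ := by
  simp only [torusDist, dist_comm]

/-- An edge of the Gilbert graph towards a smaller mark decomposes into thinned edges. -/
lemma transGen_thinnedEdge (φ : Finset (MarkedPoint d n)) (x y : {x // x ∈ φ})
    (h : GilbertEdge x.1 y.1) (hlt : y.1.2 < x.1.2) :
    Relation.TransGen (fun a b : {x // x ∈ φ} => ThinnedEdge φ a.1 b.1) x y := by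
  classical
  -- Induction on the number of points with mark strictly between the endpoint marks: a blocker lies
  -- in this set but in neither of the sets for the two halves.
  induction hm : (φ.filter fun z => y.1.2 < z.2 ∧ z.2 < x.1.2).card using Nat.strong_induction_on
    generalizing x y with
  | _ m ih =>
    by_cases hz : ∃ z ∈ φ, z.1 ∈ torusBall x.1.1 x.1.2 ∧ y.1.2 < z.2 ∧ z.2 < x.1.2 ∧
        y.1.1 ∈ torusBall z.1 z.2
    · obtain ⟨z, hzφ, hxz, hyz, hzx, hzy⟩ := hz
      refine (ih _ ?_ x ⟨z, hzφ⟩ hxz hzx rfl).trans (ih _ ?_ ⟨z, hzφ⟩ y hzy hyz rfl)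
      · rw [← hm]
        refine Finset.card_lt_card (Finset.ssubset_iff_of_subset ?_ |>.2 ⟨z, ?_, ?_⟩)
        · intro u hu
          simp only [Finset.mem_filter] at hu ⊢
          exact ⟨hu.1, hyz.trans hu.2.1, hu.2.2⟩
        · simp [hzφ, hyz, hzx]
        · simp
      · rw [← hm]
        refine Finset.card_lt_card (Finset.ssubset_iff_of_subset ?_ |>.2 ⟨z, ?_, ?_⟩)
        · intro u hu
          simp only [Finset.mem_filter] at hu ⊢
          exact ⟨hu.1, hu.2.1, hu.2.2.trans hzx⟩
        · simp [hzφ, hyz, hzx]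
        · simp
    · exact .single ⟨h, hlt, hz⟩

lemma exists_chain_of_transGen {α : Type*} {r : α → α → Prop} {x y : α}
    (h : Relation.TransGen r x y) :
    ∃ (m : ℕ) (f : ℕ → α), f 0 = x ∧ f m = y ∧ ∀ i < m, r (f i) (f (i + 1)) := by
  induction h using Relation.TransGen.head_induction_on with
  | @single a h =>
    refine ⟨1, fun i => if i = 0 then a else y, by simp, by simp, fun i hi => ?_⟩
    obtain rfl : i = 0 := by omega
    simpa using h
  | @head a b hab _ ih =>
    obtain ⟨m, f, hf0, hfm, hf⟩ := ih
    refine ⟨m + 1, fun i => Nat.casesOn i a f, rfl, hfm, fun i hi => ?_⟩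
    cases i with
    | zero => simpa [hf0] using hab
    | succ i => exact hf i (by omega)

lemma exists_walk_of_chain {V : Type*} (G : SimpleGraph V) (f : ℕ → V) (m : ℕ)
    (h : ∀ i < m, G.Adj (f i) (f (i + 1))) : ∃ p : G.Walk (f 0) (f m), p.length = m := by
  induction m with
  | zero => exact ⟨.nil, rfl⟩
  | succ m ih =>
    obtain ⟨p, hp⟩ := ih fun i hi => h i (by omega)
    exact ⟨p.concat (h m (by omega)), by simp [hp]⟩

/-- A descending chain with `k` edges in the Gilbert graph on `φ`. -/
def HasDescendingChain (φ : Finset (MarkedPoint d n)) (k : ℕ) : Prop :=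
  ∃ f : ℕ → MarkedPoint d n, (∀ i ≤ k, f i ∈ φ) ∧
    ∀ i < k, GilbertEdge (f i) (f (i + 1)) ∧ (f (i + 1)).2 < (f i).2

lemma exists_path_of_gilbertEdge {φ : Finset (MarkedPoint d n)} {k : ℕ}
    (hk : ¬ HasDescendingChain φ k) (x y : {x // x ∈ φ}) (h : GilbertEdge x.1 y.1)
    (hlt : y.1.2 < x.1.2) :
    ∃ p : (thinnedGraph φ).Walk x y, p.IsPath ∧ p.length ≤ k := by
  classical
  obtain ⟨m, f, rfl, rfl, hf⟩ := exists_chain_of_transGen (transGen_thinnedEdge φ x y h hlt)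
  have hmk : m ≤ k := by
    -- A longer chain truncates to its first `k` edges.
    by_contra! hkm
    exact hk ⟨fun i => (f i).1, fun i _ => (f i).2,
      fun i hi => ⟨(hf i (by omega)).1, (hf i (by omega)).2.1⟩⟩
  obtain ⟨p, hp⟩ := exists_walk_of_chain (thinnedGraph φ) f m fun i hi => by
    rw [thinnedGraph, SimpleGraph.fromRel_adj]
    refine ⟨fun he => ?_, Or.inl (hf i hi)⟩
    have := (hf i hi).2.1
    rw [← he] at this
    exact lt_irrefl _ this
  exact ⟨p.bypass, p.bypass_isPath, p.length_bypass_le_length.trans (hp.trans_le hmk)⟩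

lemma shortThinnedConnections_of_not_hasDescendingChain {φ : Finset (MarkedPoint d n)} {k : ℕ}
    {ℓ : ℝ} (hinj : ∀ x ∈ φ, ∀ y ∈ φ, x.2 = y.2 → x = y) (hk : ¬ HasDescendingChain φ k)
    (hkℓ : (k : ℝ) ≤ ℓ) : ShortThinnedConnections φ ℓ := by
  intro x y hxy
  rw [gilbertGraph, SimpleGraph.fromRel_adj] at hxy
  obtain ⟨hne, hxy⟩ := hxy
  wlog hE : GilbertEdge x.1 y.1 generalizing x y
  · obtain ⟨p, hp, hl⟩ := this y x hne.symm hxy.symm (hxy.resolve_left hE)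
    exact ⟨p.reverse, hp.reverse, by simpa using hl⟩
  rcases lt_trichotomy y.1.2 x.1.2 with hlt | heq | hgt
  · obtain ⟨p, hp, hl⟩ := exists_path_of_gilbertEdge hk x y hE hlt
    exact ⟨p, hp, le_trans (by exact_mod_cast hl) hkℓ⟩
  · exact absurd (Subtype.ext (hinj _ y.2 _ x.2 heq)).symm hne
  -- The ball of the larger mark also covers the distance, so the edge can be reversed to point
  -- downwards.
  · have hE' : GilbertEdge y.1 x.1 := by
      have h : torusDist x.1.1 y.1.1 ≤ x.1.2 := hE
      rw [torusDist_comm] at h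
      exact h.trans hgt.le
    obtain ⟨p, hp, hl⟩ := exists_path_of_gilbertEdge hk y x hE' hgt
    exact ⟨p.reverse, hp.reverse, le_trans (by simpa using hl) hkℓ⟩

end Graph

/-! ### Occupation probabilities of a Poisson process -/

section Poisson

lemma poissonMeasure_real_compl_zero_le (r : NNReal) : (poissonMeasure r).real {0}ᶜ ≤ r := by
  rw [probReal_compl_eq_one_sub (measurableSet_singleton _), poissonMeasure_real_singleton]
  have := Real.add_one_le_exp (-(r : ℝ))
  simp
  linarith

/-- From `exp (-r) ≥ 1 - r` one gets `1 - exp (-r) * (1 + r) ≤ 1 - (1 - r) * (1 + r)`. -/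
lemma poissonMeasure_real_compl_zero_one_le (r : NNReal) :
    (poissonMeasure r).real {0, 1}ᶜ ≤ (r : ℝ) ^ 2 := by
  have h01 : (poissonMeasure r).real {0, 1} = Real.exp (-r) * (1 + r) := by
    rw [Set.insert_eq, measureReal_union (by simp) (measurableSet_singleton _),
      poissonMeasure_real_singleton, poissonMeasure_real_singleton]
    simp
    ring
  rw [probReal_compl_eq_one_sub (Set.Finite.measurableSet (by simp)), h01]
  have := Real.add_one_le_exp (-(r : ℝ))
  nlinarith [r.2]

lemma pointCount_ne_zero_iff {S : Type*} {φ : Finset S} {B : Set S} :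
    pointCount φ B ≠ 0 ↔ ∃ x ∈ φ, x ∈ B := by
  rw [pointCount, Ne, Set.ncard_eq_zero (φ.finite_toSet.inter_of_left _),
    ← Ne, ← Set.nonempty_iff_ne_empty]
  rfl

lemma one_lt_pointCount_iff {S : Type*} {φ : Finset S} {B : Set S} :
    1 < pointCount φ B ↔ ∃ x ∈ φ, ∃ y ∈ φ, x ∈ B ∧ y ∈ B ∧ x ≠ y := by
  rw [pointCount, Set.one_lt_ncard (φ.finite_toSet.inter_of_left _)]
  simp only [Set.mem_inter_iff, Finset.mem_coe]
  constructor
  · rintro ⟨a, ⟨ha, ha'⟩, b, ⟨hb, hb'⟩, hab⟩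
    exact ⟨a, ha, b, hb, ha', hb', hab⟩
  · rintro ⟨a, ha, b, hb, ha', hb', hab⟩
    exact ⟨a, ⟨ha, ha'⟩, b, ⟨hb, hb'⟩, hab⟩

variable {Ω S : Type*} [MeasurableSpace Ω] [MeasurableSpace S] {P : Measure Ω}
  {μ : Measure S} [IsFiniteMeasure μ] {X : Ω → Finset S}

namespace IsPoissonPointProcess

lemma measureReal_pointCount_mem (hX : IsPoissonPointProcess P μ X) {B : Set S}
    (hB : MeasurableSet B) (A : Set ℕ) :
    P.real {ω | pointCount (X ω) B ∈ A} = (poissonMeasure (μ B).toNNReal).real A := by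
  rw [← hX.map_count B hB, map_measureReal_apply (hX.measurable_count B hB) (.of_discrete)]
  rfl

lemma measureReal_exists_mem_le (hX : IsPoissonPointProcess P μ X) {B : Set S}
    (hB : MeasurableSet B) : P.real {ω | ∃ x ∈ X ω, x ∈ B} ≤ μ.real B := by
  have h := hX.measureReal_pointCount_mem hB {0}ᶜ
  simp only [Set.mem_compl_iff, Set.mem_singleton_iff, ← Ne.eq_def, pointCount_ne_zero_iff] at h
  rw [h]
  exact poissonMeasure_real_compl_zero_le _

lemma measureReal_exists_pair_le (hX : IsPoissonPointProcess P μ X) {B : Set S}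
    (hB : MeasurableSet B) :
    P.real {ω | ∃ x ∈ X ω, ∃ y ∈ X ω, x ∈ B ∧ y ∈ B ∧ x ≠ y} ≤ μ.real B ^ 2 := by
  have h := hX.measureReal_pointCount_mem hB {0, 1}ᶜ
  have h1 : ∀ m : ℕ, m ∈ ({0, 1}ᶜ : Set ℕ) ↔ 1 < m := by intro m; simp; omega
  simp only [h1, one_lt_pointCount_iff] at h
  rw [h]
  exact poissonMeasure_real_compl_zero_one_le _

/-- The probability that each of finitely many disjoint sets is occupied is at most the product of
their intensities. -/
lemma measureReal_forall_exists_mem_le (hX : IsPoissonPointProcess P μ X) {k : ℕ}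
    {B : Fin k → Set S} (hB : ∀ i, MeasurableSet (B i))
    (hd : Pairwise fun i j => Disjoint (B i) (B j)) :
    P.real {ω | ∀ i, ∃ x ∈ X ω, x ∈ B i} ≤ ∏ i, μ.real (B i) := by
  have h := (hX.indep_count k B hB hd).meas_iInter
    (s := fun i => (fun ω => pointCount (X ω) (B i)) ⁻¹' {0}ᶜ)
    (fun i => ⟨{0}ᶜ, .of_discrete, rfl⟩)
  have he : {ω | ∀ i, ∃ x ∈ X ω, x ∈ B i} =
      ⋂ i, (fun ω => pointCount (X ω) (B i)) ⁻¹' {0}ᶜ := by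
    ext ω
    simp [← pointCount_ne_zero_iff]
  rw [he, measureReal_def, h, ENNReal.toReal_prod]
  refine Finset.prod_le_prod (fun _ _ => ENNReal.toReal_nonneg) fun i _ => ?_
  refine le_trans (le_of_eq ?_) (hX.measureReal_exists_mem_le (hB i))
  rw [measureReal_def]
  congr 2
  ext ω
  simp [← pointCount_ne_zero_iff]

end IsPoissonPointProcess

end Poisson

/-! ### Cells and ball volumes on the torus -/

section Torus

variable {d : ℕ} {n : ℝ}

lemma dist_le_torusDist (ξ η : Torus d n) (i : Fin d) : dist (ξ i) (η i) ≤ torusDist ξ η := by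
  refine Real.le_sqrt_of_sq_le ?_
  exact Finset.single_le_sum (f := fun i => dist (ξ i) (η i) ^ 2) (fun _ _ => sq_nonneg _)
    (Finset.mem_univ i)

/-- The torus has a finite measurable partition into cells of sup-diameter at most `1`. -/
lemma exists_cells (d : ℕ) (n : ℝ) [hn : Fact (0 < n)] :
    ∃ (K : ℕ) (loc : Torus d n → Fin d → Fin K), Measurable loc ∧
      ∀ ξ η, loc ξ = loc η → ∀ i, dist (ξ i) (η i) ≤ 1 := by
  have hlt : ∀ θ : AddCircle n, ⌊(AddCircle.equivIco n 0 θ : ℝ)⌋₊ < ⌊n⌋₊ + 1 := fun θ => by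
    have h := (AddCircle.equivIco n 0 θ).2
    have := Nat.floor_le_floor (h.2.le.trans_eq (zero_add n))
    omega
  refine ⟨⌊n⌋₊ + 1, fun ξ i => ⟨⌊(AddCircle.equivIco n 0 (ξ i) : ℝ)⌋₊, hlt _⟩, ?_, ?_⟩
  · refine measurable_pi_iff.2 fun i => ?_
    have hm : Measurable fun θ : AddCircle n => ⌊(AddCircle.equivIco n 0 θ : ℝ)⌋₊ :=
      Nat.measurable_floor.comp
        (measurable_subtype_coe.comp (AddCircle.measurableEquivIco n 0).measurable)
    have hm' : Measurable fun θ : AddCircle n =>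
        (⟨⌊(AddCircle.equivIco n 0 θ : ℝ)⌋₊, hlt θ⟩ : Fin (⌊n⌋₊ + 1)) := by
      refine measurable_to_countable' fun c => ?_
      have : (fun θ : AddCircle n =>
          (⟨⌊(AddCircle.equivIco n 0 θ : ℝ)⌋₊, hlt θ⟩ : Fin (⌊n⌋₊ + 1))) ⁻¹' {c} =
          (fun θ : AddCircle n => ⌊(AddCircle.equivIco n 0 θ : ℝ)⌋₊) ⁻¹' {c.1} := by
        ext θ
        simp [Fin.ext_iff]
      rw [this]
      exact hm (measurableSet_singleton _)
    exact hm'.comp (measurable_pi_apply i)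
  · intro ξ η h i
    have hi := congrArg Fin.val (congrFun h i)
    simp only at hi
    have key : ∀ θ : AddCircle n, ((AddCircle.equivIco n 0 θ : ℝ) : AddCircle n) = θ := fun θ =>
      AddCircle.coe_equivIco
    set a : ℝ := (AddCircle.equivIco n 0 (ξ i) : ℝ) with ha
    set b : ℝ := (AddCircle.equivIco n 0 (η i) : ℝ) with hb
    have ha0 : 0 ≤ a := (AddCircle.equivIco n 0 (ξ i)).2.1
    have hb0 : 0 ≤ b := (AddCircle.equivIco n 0 (η i)).2.1
    rw [← key (ξ i), ← key (η i), dist_eq_norm, ← AddCircle.coe_sub]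
    refine (QuotientAddGroup.norm_mk_le_norm (S := AddSubgroup.zmultiples n)).trans ?_
    have h1 := Nat.floor_le ha0
    have h2 := Nat.lt_floor_add_one a
    have h3 := Nat.floor_le hb0
    have h4 := Nat.lt_floor_add_one b
    have h5 : (⌊a⌋₊ : ℝ) = ⌊b⌋₊ := by exact_mod_cast hi
    rw [Real.norm_eq_abs, abs_le]
    constructor <;> linarith

lemma volume_real_univ_torus [hn : Fact (0 < n)] :
    (volume : Measure (Torus d n)).real Set.univ = n ^ d := by
  rw [measureReal_def, ← Set.pi_univ Set.univ, volume_pi_pi]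
  simp [hn.out.le]

lemma volume_real_le_of_forall_dist_le [hn : Fact (0 < n)] (ξ : Torus d n) {ρ : ℝ} (hρ : 0 ≤ ρ)
    {A : Set (Torus d n)} (hA : ∀ η ∈ A, ∀ i, dist (ξ i) (η i) ≤ ρ) :
    (volume : Measure (Torus d n)).real A ≤ (2 * ρ) ^ d := by
  have hsub : A ⊆ Set.univ.pi fun i => Metric.closedBall (ξ i) ρ := fun η hη i _ => by
    rw [Metric.mem_closedBall, dist_comm]
    exact hA η hη i
  refine (measureReal_mono hsub (measure_ne_top _ _)).trans ?_
  rw [measureReal_def, volume_pi_pi, ENNReal.toReal_prod]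
  refine (Finset.prod_le_prod (fun _ _ => ENNReal.toReal_nonneg)
    (g := fun _ => 2 * ρ) fun i _ => ?_).trans (by simp)
  rw [AddCircle.volume_closedBall]
  refine ENNReal.toReal_le_of_le_ofReal (by positivity) ?_
  exact ENNReal.ofReal_le_ofReal (min_le_right _ _)

/-- Two cells contain points at toroidal distance at most `ρ`. -/
def CellsWithin {ι : Type*} (loc : Torus d n → ι) (ρ : ℝ) (L L' : ι) : Prop :=
  ∃ ξ η, loc ξ = L ∧ loc η = L' ∧ torusDist ξ η ≤ ρ

open Classical in
-- The cells counted are disjoint and lie in a cube of half-side `ρ + 2` about any point of the cell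
-- `L`: one extra unit for the diameter of each of the two cells.
lemma sum_volume_cellsWithin_le [hn : Fact (0 < n)] {ι : Type*} [Fintype ι] [MeasurableSpace ι]
    [MeasurableSingletonClass ι] {loc : Torus d n → ι} (hm : Measurable loc)
    (hloc : ∀ ξ η, loc ξ = loc η → ∀ i, dist (ξ i) (η i) ≤ 1) {ρ : ℝ} (hρ : 0 ≤ ρ) (L : ι) :
    ∑ L', (volume : Measure (Torus d n)).real (loc ⁻¹' {L'}) *
      (if CellsWithin loc ρ L L' then 1 else 0) ≤ (2 * (ρ + 2)) ^ d := by
  simp only [mul_ite, mul_one, mul_zero]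
  rw [← Finset.sum_filter, sum_measureReal_preimage_singleton _
    (fun y _ => hm (measurableSet_singleton y))]
  rcases Finset.eq_empty_or_nonempty (Finset.univ.filter fun L' => CellsWithin loc ρ L L') with
    he | ⟨L₀, hL₀⟩
  · rw [he]
    simp
    positivity
  · obtain ⟨ξ, -, hξ, -, -⟩ := (Finset.mem_filter.1 hL₀).2
    refine volume_real_le_of_forall_dist_le ξ (by linarith) fun η hη i => ?_
    obtain ⟨ξ', η', hξ', hη', hd⟩ := (Finset.mem_filter.1 hη).2
    have h1 := hloc ξ ξ' (hξ.trans hξ'.symm) i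
    have h2 := hloc η' η hη' i
    have h3 := (dist_le_torusDist ξ' η' i).trans hd
    linarith [dist_triangle4 (ξ i) (ξ' i) (η' i) (η i)]

end Torus

/-! ### Summation over location and mark cells -/

section ChainSums

/-- The last location occurs in a single factor `a`, so it can be summed out at cost `V`; induction
then leaves only the free sum over the first location. -/
lemma sum_chain_le {ι J : Type*} [Fintype ι] {v : ι → ℝ} (hv : ∀ L, 0 ≤ v L)
    {a : J → ι → ι → ℝ} (ha : ∀ j L L', 0 ≤ a j L L') {V : J → ℝ} (hV0 : ∀ j, 0 ≤ V j)
    (hV : ∀ j L, ∑ L', v L' * a j L L' ≤ V j) (k : ℕ) (j : Fin k → J) :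
    ∑ L : Fin (k + 1) → ι, (∏ i, v (L i)) * ∏ i : Fin k, a (j i) (L i.castSucc) (L i.succ) ≤
      (∑ L, v L) * ∏ i, V (j i) := by
  induction k with
  | zero =>
    simp only [Finset.univ_eq_empty, Finset.prod_empty, mul_one]
    rw [← (Equiv.funUnique (Fin 1) ι).sum_comp]
    simp
  | succ k ih =>
    rw [← (Fin.snocEquiv fun _ : Fin (k + 2) => ι).sum_comp, Fintype.sum_prod_type_right]
    have hterm : ∀ (L : Fin (k + 1) → ι) (l : ι),
        ((∏ i, v ((Fin.snocEquiv fun _ : Fin (k + 2) => ι) (l, L) i)) *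
          ∏ i : Fin (k + 1), a (j i) ((Fin.snocEquiv fun _ : Fin (k + 2) => ι) (l, L) i.castSucc)
            ((Fin.snocEquiv fun _ : Fin (k + 2) => ι) (l, L) i.succ)) =
        ((∏ i, v (L i)) * ∏ i : Fin k, a (j i.castSucc) (L i.castSucc) (L i.succ)) *
          (v l * a (j (Fin.last k)) (L (Fin.last k)) l) := by
      intro L l
      rw [Fin.prod_univ_castSucc (n := k), Fin.prod_univ_castSucc (n := k + 1)]
      simp only [Fin.snocEquiv_apply, Fin.snoc_castSucc, Fin.snoc_last, Fin.succ_last,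
        ← Fin.castSucc_succ]
      ring
    simp only [hterm, ← Finset.mul_sum]
    calc _ ≤ ∑ L : Fin (k + 1) → ι, ((∏ i, v (L i)) *
            ∏ i : Fin k, a (j i.castSucc) (L i.castSucc) (L i.succ)) * V (j (Fin.last k)) :=
          Finset.sum_le_sum fun L _ => mul_le_mul_of_nonneg_left (hV _ _)
            (mul_nonneg (Finset.prod_nonneg fun _ _ => hv _)
              (Finset.prod_nonneg fun _ _ => ha _ _ _))
      _ ≤ ((∑ L, v L) * ∏ i : Fin k, V (j i.castSucc)) * V (j (Fin.last k)) := by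
          rw [← Finset.sum_mul]
          exact mul_le_mul_of_nonneg_right (ih fun i => j i.castSucc) (hV0 _)
      _ = _ := by rw [Fin.prod_univ_castSucc (n := k)]; ring

open Classical in
/-- The elementary symmetric function of degree `k` is at most `exp (-k + e ∑ w)`. -/
lemma sum_strictAnti_prod_le {N : ℕ} {w : Fin N → ℝ} (hw : ∀ j, 0 ≤ w j) (k : ℕ) :
    ∑ j : Fin k → Fin N with StrictAnti j, ∏ i, w (j i) ≤
      Real.exp (-k + Real.exp 1 * ∑ j, w j) := by
  have himg : ∀ j ∈ Finset.univ.filter fun j : Fin k → Fin N => StrictAnti j,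
      (Finset.univ.image j).card = k := fun j hj => by
    rw [Finset.card_image_of_injective _ (Finset.mem_filter.1 hj).2.injective]
    simp
  have hterm : ∀ j ∈ Finset.univ.filter fun j : Fin k → Fin N => StrictAnti j,
      -- Scaling each of the `k` weights by `e` is what produces the factor `exp (-k)`.
      ∏ i, w (j i) = Real.exp (-k) * ∏ l ∈ Finset.univ.image j, Real.exp 1 * w l := fun j hj => by
    rw [Finset.prod_mul_distrib, Finset.prod_const, himg j hj, ← mul_assoc, ← Real.exp_nat_mul,
      ← Real.exp_add, Finset.prod_image
        fun a _ b _ h => (Finset.mem_filter.1 hj).2.injective h]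
    simp
  -- A strictly decreasing tuple is determined by its range, so the sum is dominated by one over all
  -- subsets, which factorises.
  have hinj : Set.InjOn (fun j : Fin k → Fin N => Finset.univ.image j)
      (Finset.univ.filter fun j : Fin k → Fin N => StrictAnti j : Finset (Fin k → Fin N)) := by
    intro j hj j' hj' h
    refine (StrictAnti.range_inj (Finset.mem_filter.1 hj).2 (Finset.mem_filter.1 hj').2).1 ?_
    have := congrArg (fun s : Finset (Fin N) => (s : Set (Fin N))) h
    simpa using this
  rw [Finset.sum_congr rfl hterm, ← Finset.mul_sum, Real.exp_add]
  refine mul_le_mul_of_nonneg_left ?_ (Real.exp_nonneg _)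
  rw [← Finset.sum_image (f := fun s : Finset (Fin N) => ∏ l ∈ s, Real.exp 1 * w l) hinj]
  calc _ ≤ ∑ s ∈ (Finset.univ : Finset (Fin N)).powerset, ∏ l ∈ s, Real.exp 1 * w l :=
        Finset.sum_le_sum_of_subset_of_nonneg (fun _ _ => by simp)
          fun _ _ _ => Finset.prod_nonneg fun _ _ => mul_nonneg (Real.exp_nonneg _) (hw _)
    _ = ∏ l, (1 + Real.exp 1 * w l) := (Finset.prod_one_add _).symm
    _ ≤ Real.exp (∑ l, Real.exp 1 * w l) := by
        rw [Real.exp_sum]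
        refine Finset.prod_le_prod
          (fun l _ => add_nonneg zero_le_one (mul_nonneg (Real.exp_nonneg _) (hw _))) fun l _ => ?_
        linarith [Real.add_one_le_exp (Real.exp 1 * w l)]
    _ = _ := by rw [← Finset.mul_sum]

open Classical in
-- The final point of a chain has no outgoing hop and hence no volume factor: its mark is split off,
-- and dropping its order constraint gives the factor `∑ j, p j`.
lemma sum_strictAnti_chain_le {ι : Type*} [Fintype ι] {N : ℕ} {v : ι → ℝ} (hv : ∀ L, 0 ≤ v L)
    {p : Fin N → ℝ} (hp : ∀ j, 0 ≤ p j)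
    {a : Fin N → ι → ι → ℝ} (ha : ∀ j L L', 0 ≤ a j L L') {V : Fin N → ℝ} (hV0 : ∀ j, 0 ≤ V j)
    (hV : ∀ j L, ∑ L', v L' * a j L L' ≤ V j) (k : ℕ) :
    ∑ j : Fin (k + 1) → Fin N with StrictAnti j, ∑ L : Fin (k + 1) → ι,
      (∏ i, v (L i) * p (j i)) * ∏ i : Fin k, a (j i.castSucc) (L i.castSucc) (L i.succ) ≤
      (∑ L, v L) * (∑ j, p j) * Real.exp (-k + Real.exp 1 * ∑ j, V j * p j) := by
  have h1 : ∀ j : Fin (k + 1) → Fin N, ∑ L : Fin (k + 1) → ι,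
      (∏ i, v (L i) * p (j i)) * ∏ i : Fin k, a (j i.castSucc) (L i.castSucc) (L i.succ) ≤
      (∑ L, v L) * (p (j (Fin.last k)) * ∏ i : Fin k, V (j i.castSucc) * p (j i.castSucc)) := by
    intro j
    calc _ = (∏ i, p (j i)) * ∑ L : Fin (k + 1) → ι,
          (∏ i, v (L i)) * ∏ i : Fin k, a (j i.castSucc) (L i.castSucc) (L i.succ) := by
          rw [Finset.mul_sum]
          refine Finset.sum_congr rfl fun L _ => ?_
          rw [Finset.prod_mul_distrib]
          ring
      _ ≤ (∏ i, p (j i)) * ((∑ L, v L) * ∏ i : Fin k, V (j i.castSucc)) :=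
          mul_le_mul_of_nonneg_left (sum_chain_le hv ha hV0 hV k fun i => j i.castSucc)
            (Finset.prod_nonneg fun _ _ => hp _)
      _ = _ := by
          rw [Fin.prod_univ_castSucc, Finset.prod_mul_distrib]
          ring
  have hv0 : 0 ≤ ∑ L, v L := Finset.sum_nonneg fun _ _ => hv _
  have hw : ∀ j, 0 ≤ V j * p j := fun j => mul_nonneg (hV0 j) (hp j)
  refine (Finset.sum_le_sum fun j _ => h1 j).trans ?_
  rw [← Finset.mul_sum, mul_assoc]
  refine mul_le_mul_of_nonneg_left ?_ hv0
  calc _ = ∑ x : Fin N × (Fin k → Fin N),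
        if StrictAnti ((Fin.snocEquiv fun _ : Fin (k + 1) => Fin N) x) then
          p x.1 * ∏ i, V (x.2 i) * p (x.2 i) else 0 := by
        rw [Finset.sum_filter, ← (Fin.snocEquiv fun _ : Fin (k + 1) => Fin N).sum_comp]
        simp [Fin.snocEquiv_apply]
    _ ≤ ∑ x : Fin N × (Fin k → Fin N),
        p x.1 * if StrictAnti x.2 then ∏ i, V (x.2 i) * p (x.2 i) else 0 := by
        refine Finset.sum_le_sum fun x _ => ?_
        have h0 : 0 ≤ ∏ i, V (x.2 i) * p (x.2 i) := Finset.prod_nonneg fun _ _ => hw _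
        by_cases hx : StrictAnti ((Fin.snocEquiv fun _ : Fin (k + 1) => Fin N) x)
        · have hx2 : StrictAnti x.2 := fun i i' hii => by
            simpa [Fin.snocEquiv_apply] using hx (Fin.castSucc_lt_castSucc_iff.2 hii)
          simp [hx, hx2]
        · rw [if_neg hx]
          exact mul_nonneg (hp _) (by split_ifs <;> simp [h0])
    _ = (∑ j, p j) * ∑ j : Fin k → Fin N with StrictAnti j, ∏ i, V (j i) * p (j i) := by
        rw [Fintype.sum_prod_type, Finset.sum_filter, Finset.sum_mul_sum]
    _ ≤ _ := mul_le_mul_of_nonneg_left (sum_strictAnti_prod_le hw k)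
        (Finset.sum_nonneg fun _ _ => hp _)

end ChainSums

/-! ### Mark cells and tail estimates -/

section Tail

/-- The `j`-th cell of the partition of `[0, ∞)` into intervals of length `δ`. -/
def markCell (δ : ℝ) (j : ℕ) : Set ℝ := Set.Ico (j * δ) ((j + 1) * δ)

lemma measurableSet_markCell (δ : ℝ) (j : ℕ) : MeasurableSet (markCell δ j) := measurableSet_Ico

lemma le_of_mem_markCell {δ : ℝ} (hδ : 0 < δ) {j j' : ℕ} {r r' : ℝ} (hr : r ∈ markCell δ j)
    (hr' : r' ∈ markCell δ j') (h : r ≤ r') : j ≤ j' := by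
  have h1 : (j : ℝ) * δ < (j' + 1) * δ := hr.1.trans_lt (h.trans_lt hr'.2)
  have h2 : (j : ℝ) < j' + 1 := lt_of_mul_lt_mul_right h1 hδ.le
  have : j < j' + 1 := by exact_mod_cast h2
  omega

lemma disjoint_markCell {δ : ℝ} (hδ : 0 < δ) {j j' : ℕ} (h : j ≠ j') :
    Disjoint (markCell δ j) (markCell δ j') :=
  Set.disjoint_left.2 fun _ hr hr' =>
    h (le_antisymm (le_of_mem_markCell hδ hr hr' le_rfl) (le_of_mem_markCell hδ hr' hr le_rfl))

lemma exists_mem_markCell {δ : ℝ} (hδ : 0 < δ) {N : ℕ} {r : ℝ} (h0 : 0 ≤ r) (hN : r < N * δ) :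
    ∃ j : Fin N, r ∈ markCell δ j := by
  have h1 := Nat.floor_le (div_nonneg h0 hδ.le)
  have h2 := Nat.lt_floor_add_one (r / δ)
  rw [le_div_iff₀ hδ] at h1
  rw [div_lt_iff₀ hδ] at h2
  refine ⟨⟨⌊r / δ⌋₊, ?_⟩, h1, h2⟩
  rw [Nat.floor_lt (div_nonneg h0 hδ.le), div_lt_iff₀ hδ]
  exact hN

lemma sum_markCell_le (ν : Measure ℝ) [IsProbabilityMeasure ν] {δ : ℝ} (hδ : 0 < δ) {N : ℕ}
    (s : Finset (Fin N)) {A : Set ℝ} (hA : ∀ j ∈ s, markCell δ j ⊆ A) :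
    ∑ j ∈ s, ν.real (markCell δ j) ≤ ν.real A := by
  rw [← measureReal_biUnion_finset
    (fun i _ j _ hij => disjoint_markCell hδ (Fin.val_ne_of_ne hij))
    fun j _ => measurableSet_markCell δ j]
  exact measureReal_mono (Set.iUnion₂_subset hA)

variable {ν : Measure ℝ} [IsProbabilityMeasure ν] {β s : ℝ}

/-- The tail limit handles large `h`, where `h ^ d ≤ h ^ s`; below the threshold the trivial bound
on a probability suffices. -/
lemma IsHeavyTailedRadiusLaw.exists_tail_bound (hν : IsHeavyTailedRadiusLaw ν β s) {d : ℕ}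
    (hs : (d : ℝ) ≤ s) :
    ∃ C : ℝ, 0 < C ∧ ∀ h : ℝ, 0 ≤ h → ν.real (Set.Ici h) * (1 + h) ^ d ≤ C := by
  have hev := (hν.tail.eventually (gt_mem_nhds (lt_add_one β))).and (eventually_ge_atTop (1 : ℝ))
  obtain ⟨h₀, hh₀⟩ := eventually_atTop.1 hev
  have h₀1 : 1 ≤ max h₀ 1 := le_max_right _ _
  have hβ := hν.beta_pos
  refine ⟨2 ^ d * (β + 1) + (1 + max h₀ 1) ^ d, by positivity, fun h hh => ?_⟩
  have hn : 0 ≤ ν.real (Set.Ici h) := measureReal_nonneg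
  rcases le_total h (max h₀ 1) with hle | hge
  · have h1 : (1 + h) ^ d ≤ (1 + max h₀ 1) ^ d := by gcongr
    have h2 : ν.real (Set.Ici h) ≤ 1 := measureReal_le_one
    have h3 : ν.real (Set.Ici h) * (1 + h) ^ d ≤ 1 * (1 + max h₀ 1) ^ d := by gcongr
    have h4 : 0 ≤ 2 ^ d * (β + 1) := by positivity
    linarith
  · obtain ⟨htail, h1⟩ := hh₀ h ((le_max_left _ _).trans hge)
    have hIci : ν.real (Set.Ici h) = ν.real (Set.Ioi h) :=
      measureReal_congr
        (Ioi_ae_eq_Ici' (hν.absolutelyContinuous (measure_singleton h))).symm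
    have hpow : (1 + h) ^ d ≤ 2 ^ d * h ^ s := by
      calc (1 + h) ^ d ≤ (2 * h) ^ d := by gcongr; linarith
        _ = 2 ^ d * h ^ (d : ℝ) := by rw [mul_pow, Real.rpow_natCast]
        _ ≤ _ := by gcongr
    calc ν.real (Set.Ici h) * (1 + h) ^ d ≤ ν.real (Set.Ici h) * (2 ^ d * h ^ s) := by gcongr
      _ = 2 ^ d * (h ^ s * ν.real (Set.Ioi h)) := by rw [hIci]; ring
      _ ≤ 2 ^ d * (β + 1) := by gcongr
      _ ≤ _ := le_add_of_nonneg_right (by positivity)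

/-- Absolute continuity of the integral of the density makes one mesh width work for all cells at
once. -/
lemma exists_forall_markCell_le (hν : ν ≪ volume) {γ : ℝ} (hγ : 0 < γ) :
    ∃ q : ℕ, 0 < q ∧ ∀ j, ν.real (markCell (1 / q) j) ≤ γ := by
  have hfin : ∫⁻ x, ν.rnDeriv volume x ≠ ⊤ := (Measure.lintegral_rnDeriv_lt_top ν volume).ne
  obtain ⟨η, hη, h⟩ := exists_pos_setLIntegral_lt_of_measure_lt hfin
    (ENNReal.ofReal_pos.2 hγ).ne'
  obtain ⟨q, hq⟩ := ENNReal.exists_inv_nat_lt hη.ne'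
  have hq0 : q ≠ 0 := by
    rintro rfl
    simp at hq
  refine ⟨q, Nat.pos_of_ne_zero hq0, fun j => ?_⟩
  refine ENNReal.toReal_le_of_le_ofReal hγ.le ?_
  have hvol : volume (markCell (1 / q) j) < η := by
    have h1 : ((j : ℝ) + 1) * (1 / q) - j * (1 / q) = (q : ℝ)⁻¹ := by ring
    rw [markCell, Real.volume_Ico, h1, ENNReal.ofReal_inv_of_pos (by positivity),
      ENNReal.ofReal_natCast]
    exact hq
  have h2 := (h _ hvol).le
  rwa [← withDensity_apply _ (measurableSet_markCell _ _),
    Measure.withDensity_rnDeriv_eq _ _ hν] at h2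

/-- Up to level `2 ^ K`, each dyadic scale of the marks contributes a bounded amount. -/
lemma sum_volume_mul_markCell_le {d : ℕ} {C : ℝ}
    (htail : ∀ h : ℝ, 0 ≤ h → ν.real (Set.Ici h) * (1 + h) ^ d ≤ C) {δ : ℝ} (hδ : 0 < δ)
    (hδ1 : δ ≤ 1) {N K : ℕ} (hK : N * δ + 1 ≤ 2 ^ K) :
    ∑ j : Fin N, (2 * ((j + 1) * δ + 2)) ^ d * ν.real (markCell δ j) ≤ K * (8 ^ d * C) := by
  classical
  have hterm : ∀ j : Fin N, (2 * ((j + 1) * δ + 2)) ^ d * ν.real (markCell δ j) ≤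
      ∑ m ∈ Finset.range K, if (2 : ℝ) ^ m ≤ j * δ + 1 then
        (8 * 2 ^ m) ^ d * ν.real (markCell δ j) else 0 := by
    intro j
    have hj0 : (0 : ℝ) ≤ j * δ := by positivity
    -- The dyadic scale of `j * δ + 1`. Only its lower bound is kept in the indicator, so scales
    -- overlap and each is controlled by the tail at `2 ^ m - 1`.
    obtain ⟨m, hm, hm'⟩ := exists_nat_pow_near (x := (j : ℝ) * δ + 1) (by linarith)
      (one_lt_two : (1 : ℝ) < 2)
    have hmK : m < K := by
      refine (pow_lt_pow_iff_right₀ (one_lt_two : (1 : ℝ) < 2)).1 (hm.trans_lt ?_)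
      refine lt_of_lt_of_le ?_ hK
      have : (j : ℝ) < N := by exact_mod_cast j.2
      have := mul_lt_mul_of_pos_right this hδ
      linarith
    refine le_trans ?_ (Finset.single_le_sum (fun m _ => ?_) (Finset.mem_range.2 hmK))
    · rw [if_pos hm]
      refine mul_le_mul_of_nonneg_right ?_ measureReal_nonneg
      refine pow_le_pow_left₀ (by positivity) ?_ d
      have h1 : (1 : ℝ) ≤ 2 ^ m := one_le_pow₀ one_le_two
      rw [pow_succ] at hm'
      linarith
    · split_ifs
      · exact mul_nonneg (by positivity) measureReal_nonneg
      · exact le_rfl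
  refine (Finset.sum_le_sum fun j _ => hterm j).trans ?_
  rw [Finset.sum_comm]
  refine (Finset.sum_le_card_nsmul _ _ (8 ^ d * C) fun m _ => ?_).trans (by simp)
  rw [← Finset.sum_filter, ← Finset.mul_sum, mul_pow, mul_assoc]
  refine mul_le_mul_of_nonneg_left ?_ (by positivity)
  have h1 : (1 : ℝ) ≤ 2 ^ m := one_le_pow₀ one_le_two
  refine le_trans ?_ (htail (2 ^ m - 1) (by linarith))
  rw [mul_comm, add_sub_cancel]
  refine mul_le_mul_of_nonneg_right (sum_markCell_le ν hδ _ fun j hj r hr => ?_) (by positivity)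
  have := (Finset.mem_filter.1 hj).2
  have := hr.1
  rw [Set.mem_Ici]
  linarith

end Tail

/-! ### Probability of the bad events -/

section Main

variable {d : ℕ} {n : ℝ} {δ : ℝ} {N : ℕ}

/-- All marks of `φ` lie in the first `N` mark cells, and no mark cell is occupied twice. -/
structure IsSeparated (δ : ℝ) (N : ℕ) (φ : Finset (MarkedPoint d n)) : Prop where
  exists_mem : ∀ x ∈ φ, ∃ j : Fin N, x.2 ∈ markCell δ j
  eq_of_mem : ∀ j : Fin N, ∀ x ∈ φ, ∀ y ∈ φ, x.2 ∈ markCell δ j → y.2 ∈ markCell δ j → x = y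

/-- Consecutive chain points have different marks, so separation puts them in different mark cells
and the cell indices drop strictly. The upper end of a mark cell bounds the radius. -/
lemma IsSeparated.exists_cells_of_hasDescendingChain {φ : Finset (MarkedPoint d n)} {k : ℕ}
    (hφ : IsSeparated δ N φ) (hδ : 0 < δ) (h : HasDescendingChain φ k) {ι : Type*}
    (loc : Torus d n → ι) :
    ∃ (j : Fin (k + 1) → Fin N) (L : Fin (k + 1) → ι), StrictAnti j ∧
      (∀ i : Fin k, CellsWithin loc ((j i.castSucc + 1) * δ) (L i.castSucc) (L i.succ)) ∧
      ∀ i, ∃ x ∈ φ, x ∈ (loc ⁻¹' {L i}) ×ˢ markCell δ (j i) := by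
  obtain ⟨f, hfφ, hf⟩ := h
  choose j hj using fun i : Fin (k + 1) => hφ.exists_mem (f i) (hfφ i (by omega))
  refine ⟨j, fun i => loc (f i).1, Fin.strictAnti_iff_succ_lt.2 fun i => ?_, fun i => ?_,
    fun i => ⟨f i, hfφ i (by omega), rfl, hj i⟩⟩
  · have hlt : (f (i + 1)).2 < (f i).2 := (hf i i.2).2
    have h1 := hj i.castSucc
    have h2 := hj i.succ
    simp only [Fin.val_castSucc, Fin.val_succ] at h1 h2
    refine lt_of_le_of_ne (le_of_mem_markCell hδ h2 h1 hlt.le) fun he => ?_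
    rw [he] at h2
    have := hφ.eq_of_mem _ _ (hfφ (i + 1) (by omega)) _ (hfφ i (by omega)) h2 h1
    rw [this] at hlt
    exact lt_irrefl _ hlt
  · refine ⟨(f i).1, (f (i + 1)).1, rfl, rfl, ?_⟩
    have h1 : torusDist (f i).1 (f (i + 1)).1 ≤ (f i).2 := (hf i i.2).1
    exact h1.trans (hj i.castSucc).2.le

variable {Ω : Type*} [MeasurableSpace Ω] {P : Measure Ω} [IsProbabilityMeasure P]
  {ν : Measure ℝ} [IsProbabilityMeasure ν] [hn : Fact (0 < n)]
  {X : Ω → Finset (MarkedPoint d n)}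

lemma measureReal_hasDescendingChain_le (hX : IsMarkedPoissonProcess P ν X) (hδ : 0 < δ) (N k : ℕ) :
    P.real {ω | IsSeparated δ N (X ω) ∧ HasDescendingChain (X ω) k} ≤
      n ^ d * Real.exp (-k + Real.exp 1 *
        ∑ j : Fin N, (2 * ((j + 1) * δ + 2)) ^ d * ν.real (markCell δ j)) := by
  classical
  obtain ⟨K, loc, hm, hloc⟩ := exists_cells d n
  set v : (Fin d → Fin K) → ℝ := fun L => (volume : Measure (Torus d n)).real (loc ⁻¹' {L})
  set a : Fin N → (Fin d → Fin K) → (Fin d → Fin K) → ℝ :=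
    fun j L L' => if CellsWithin loc ((j + 1) * δ) L L' then 1 else 0 with ha
  have hprod : ∀ (j : Fin (k + 1) → Fin N) (L : Fin (k + 1) → Fin d → Fin K), StrictAnti j →
      P.real {ω | (∀ i : Fin k,
          CellsWithin loc ((j i.castSucc + 1) * δ) (L i.castSucc) (L i.succ)) ∧
        ∀ i, ∃ x ∈ X ω, x ∈ (loc ⁻¹' {L i}) ×ˢ markCell δ (j i)} ≤
      (∏ i, v (L i) * ν.real (markCell δ (j i))) *
        ∏ i : Fin k, a (j i.castSucc) (L i.castSucc) (L i.succ) := by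
    intro j L hj
    by_cases hL : ∀ i : Fin k,
      CellsWithin loc ((j i.castSucc + 1) * δ) (L i.castSucc) (L i.succ)
    · have h1 : ∏ i : Fin k, a (j i.castSucc) (L i.castSucc) (L i.succ) = 1 :=
        Finset.prod_eq_one fun i _ => if_pos (hL i)
      rw [h1, mul_one]
      simp only [hL, implies_true, true_and]
      refine (IsPoissonPointProcess.measureReal_forall_exists_mem_le hX
        (fun i => (hm (measurableSet_singleton _)).prod (measurableSet_markCell _ _))
        fun i i' hii => ?_).trans_eq ?_
      · exact Set.disjoint_prod.2
          -- Disjointness comes from the marks alone; a chain may revisit a location cell.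
          (Or.inr (disjoint_markCell hδ (Fin.val_ne_of_ne (hj.injective.ne hii))))
      · simp only [measureReal_prod_prod, v]
    · simp only [hL, false_and, Set.ofPred_false, measureReal_empty]
      exact mul_nonneg (Finset.prod_nonneg fun _ _ => mul_nonneg measureReal_nonneg
        measureReal_nonneg) (Finset.prod_nonneg fun _ _ => by rw [ha]; positivity)
  have hsub : {ω | IsSeparated δ N (X ω) ∧ HasDescendingChain (X ω) k} ⊆
      ⋃ j ∈ Finset.univ.filter fun j : Fin (k + 1) → Fin N => StrictAnti j,
        ⋃ L ∈ (Finset.univ : Finset (Fin (k + 1) → Fin d → Fin K)), {ω | (∀ i : Fin k,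
          CellsWithin loc ((j i.castSucc + 1) * δ) (L i.castSucc) (L i.succ)) ∧
        ∀ i, ∃ x ∈ X ω, x ∈ (loc ⁻¹' {L i}) ×ˢ markCell δ (j i)} := by
    rintro ω ⟨hsep, hch⟩
    obtain ⟨j, L, hj, hL, hω⟩ := hsep.exists_cells_of_hasDescendingChain hδ hch loc
    exact Set.mem_biUnion (Finset.mem_filter.2 ⟨Finset.mem_univ j, hj⟩)
      (Set.mem_biUnion (Finset.mem_univ L) ⟨hL, hω⟩)
  have hsum := sum_strictAnti_chain_le (v := v) (fun _ => measureReal_nonneg)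
    (p := fun j : Fin N => ν.real (markCell δ j)) (fun _ => measureReal_nonneg) (a := a)
    (fun j L L' => by rw [ha]; positivity)
    (V := fun j : Fin N => (2 * ((j + 1) * δ + 2)) ^ d) (fun j => by positivity)
    (fun j L => sum_volume_cellsWithin_le hm hloc (by positivity) L) k
  have hv : ∑ L, v L = n ^ d := by
    rw [sum_measureReal_preimage_singleton _ fun L _ => hm (measurableSet_singleton L)]
    simp [volume_real_univ_torus]
  have hp : ∑ j : Fin N, ν.real (markCell δ j) ≤ 1 :=
    (sum_markCell_le ν hδ Finset.univ fun j _ => Set.subset_univ _).trans measureReal_le_one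
  have hn0 := hn.out
  refine (measureReal_mono hsub (measure_ne_top _ _)).trans ?_
  refine (measureReal_biUnion_finset_le _ _).trans ?_
  refine (Finset.sum_le_sum fun j hj => (measureReal_biUnion_finset_le _ _).trans
    (Finset.sum_le_sum fun L _ => hprod j L (Finset.mem_filter.1 hj).2)).trans ?_
  refine hsum.trans ?_
  rw [hv]
  refine mul_le_mul_of_nonneg_right ?_ (Real.exp_nonneg _)
  exact mul_le_of_le_one_right (by positivity) hp

lemma measureReal_not_isSeparated_le (hX : IsMarkedPoissonProcess P ν X) (hν : ν (Set.Iio 0) = 0)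
    (hδ : 0 < δ) (N : ℕ) {γ : ℝ} (hγ : ∀ j, ν.real (markCell δ j) ≤ γ) :
    P.real {ω | ¬ IsSeparated δ N (X ω)} ≤
      n ^ d * ν.real (Set.Ici (N * δ)) + (n ^ d) ^ 2 * γ := by
  have hn0 := hn.out
  have hsub : {ω | ¬ IsSeparated δ N (X ω)} ⊆
      {ω | ∃ x ∈ X ω, x ∈ Set.univ ×ˢ (Set.Iio 0 ∪ Set.Ici (N * δ))} ∪
      ⋃ j ∈ (Finset.univ : Finset (Fin N)), {ω | ∃ x ∈ X ω, ∃ y ∈ X ω,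
        x ∈ Set.univ ×ˢ markCell δ j ∧ y ∈ Set.univ ×ˢ markCell δ j ∧ x ≠ y} := by
    intro ω hω
    by_contra hcon
    simp only [Set.mem_union, Set.mem_iUnion, Set.mem_ofPred_eq, Set.mem_prod, Set.mem_univ,
      true_and, not_or, not_exists, not_and, Set.mem_Iio, Set.mem_Ici, not_lt, not_le,
      Finset.mem_univ, exists_prop, ne_eq, not_not] at hcon
    exact hω ⟨fun x hx => exists_mem_markCell hδ (hcon.1 x hx).1 (hcon.1 x hx).2,
      fun j x hx y hy hxj hyj => hcon.2 j x hx y hy hxj hyj⟩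
  refine (measureReal_mono hsub).trans ((measureReal_union_le _ _).trans (add_le_add ?_ ?_))
  · refine (hX.measureReal_exists_mem_le
      (MeasurableSet.univ.prod (measurableSet_Iio.union measurableSet_Ici))).trans ?_
    rw [measureReal_prod_prod, volume_real_univ_torus]
    refine mul_le_mul_of_nonneg_left ((measureReal_union_le _ _).trans ?_) (by positivity)
    simp [measureReal_def, hν]
  · refine (measureReal_biUnion_finset_le _ _).trans ?_
    -- One of the two factors `ν.real (markCell δ j)` is bounded by `γ`, the other sums to at most
    -- one. The result does not involve `N`, which matters because the mesh is chosen after `γ`.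
    calc _ ≤ ∑ j : Fin N, (n ^ d) ^ 2 * (γ * ν.real (markCell δ j)) := by
          refine Finset.sum_le_sum fun j _ => ?_
          refine (hX.measureReal_exists_pair_le
            (MeasurableSet.univ.prod (measurableSet_markCell δ j))).trans ?_
          rw [measureReal_prod_prod, volume_real_univ_torus, mul_pow, sq (ν.real _)]
          gcongr
          exact hγ j
      _ = (n ^ d) ^ 2 * (γ * ∑ j : Fin N, ν.real (markCell δ j)) := by
          rw [← Finset.mul_sum, ← Finset.mul_sum]
      _ ≤ _ := by
          refine mul_le_mul_of_nonneg_left ?_ (by positivity)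
          refine mul_le_of_le_one_right (measureReal_nonneg.trans (hγ 0)) ?_
          exact (sum_markCell_le ν hδ Finset.univ fun j _ => Set.subset_univ _).trans
            measureReal_le_one

lemma measureReal_not_shortThinnedConnections_le (hX : IsMarkedPoissonProcess P ν X)
    (hν : ν (Set.Iio 0) = 0) (hδ : 0 < δ) (N k : ℕ) {γ : ℝ}
    (hγ : ∀ j, ν.real (markCell δ j) ≤ γ) {ℓ : ℝ} (hkℓ : (k : ℝ) ≤ ℓ) :
    P.real {ω | ¬ ShortThinnedConnections (X ω) ℓ} ≤
      n ^ d * ν.real (Set.Ici (N * δ)) + (n ^ d) ^ 2 * γ +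
        n ^ d * Real.exp (-k + Real.exp 1 *
          ∑ j : Fin N, (2 * ((j + 1) * δ + 2)) ^ d * ν.real (markCell δ j)) := by
  have hsub : {ω | ¬ ShortThinnedConnections (X ω) ℓ} ⊆ {ω | ¬ IsSeparated δ N (X ω)} ∪
      {ω | IsSeparated δ N (X ω) ∧ HasDescendingChain (X ω) k} := by
    intro ω hω
    by_contra hcon
    simp only [Set.mem_union, Set.mem_ofPred_eq, not_or, not_not, not_and] at hcon
    refine hω (shortThinnedConnections_of_not_hasDescendingChain (fun x hx y hy hxy => ?_)
      (hcon.2 hcon.1) hkℓ)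
    obtain ⟨j, hj⟩ := hcon.1.exists_mem x hx
    exact hcon.1.eq_of_mem j x hx y hy hj (hxy ▸ hj)
  exact (measureReal_mono hsub).trans ((measureReal_union_le _ _).trans
    (add_le_add (measureReal_not_isSeparated_le hX hν hδ N hγ)
      (measureReal_hasDescendingChain_le hX hδ N k)))

end Main

end ScaleFreeGilbert

/-! ### Choice of parameters -/

theorem theorem7 (d : ℕ) (hd : 2 ≤ d) (ν : Measure ℝ) [IsProbabilityMeasure ν] (β s : ℝ)
    (hν : ScaleFreeGilbert.IsHeavyTailedRadiusLaw ν β s) (hs : (d : ℝ) ≤ s) :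
    ∃ c₁ : ℝ, 0 < c₁ ∧ ∀ ε : ℝ, 0 < ε → ∃ n₀ : ℝ, ∀ (n : ℝ) [Fact (0 < n)], n₀ ≤ n →
      ∀ (Ω : Type*) [MeasurableSpace Ω] (P : Measure Ω) [IsProbabilityMeasure P]
        (X : Ω → Finset (ScaleFreeGilbert.MarkedPoint d n)),
        ScaleFreeGilbert.IsMarkedPoissonProcess P ν X →
        P {ω | ¬ ScaleFreeGilbert.ShortThinnedConnections (X ω) (c₁ * Real.log n)}
          ≤ ENNReal.ofReal ε := by
  open ScaleFreeGilbert in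
  obtain ⟨C, hC, htail⟩ := hν.exists_tail_bound hs
  set C₂ : ℝ := 6 * (8 ^ d * C) with hC₂
  have hC₂0 : 0 < C₂ := by positivity
  -- Here `e * C₂` absorbs the total weight, `d` the factor `n ^ d`, and the final `1` leaves a
  -- bound of `1 / n`.
  set b : ℝ := Real.exp 1 * C₂ + d + 1 with hb
  have hb0 : 0 < b := by positivity
  -- The extra `1` in the constant pays for rounding `k` up, as `log n ≥ 1` for `n ≥ 3`. The three
  -- error terms add up to at most `(C + 2) / n`.
  refine ⟨b + 1, by positivity, fun ε hε => ⟨max 3 ((C + 2) / ε), fun n hnF hn Ω _ P _ X hX => ?_⟩⟩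
  have hn3 : 3 ≤ n := (le_max_left _ _).trans hn
  have hnε : (C + 2) / ε ≤ n := (le_max_right _ _).trans hn
  have hn0 : 0 < n := by linarith
  have hlog : 1 ≤ Real.log n := by
    rw [Real.le_log_iff_exp_le hn0]
    linarith [Real.exp_one_lt_d9]
  -- The mesh may depend on `n`, since the weight bound uses only `δ ≤ 1`. With this `γ` the
  -- collision term is `1 / n`.
  obtain ⟨q, hq, hγ⟩ := exists_forall_markCell_le hν.absolutelyContinuous
    (γ := 1 / ((n ^ d) ^ 2 * n)) (by positivity)
  have hq' : (0 : ℝ) < q := by exact_mod_cast hq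
  -- Marks are cut off at height about `n ^ 2`: the tail there is `O(n ^ (-2 * d))`, which beats the
  -- intensity `n ^ d`.
  set N : ℕ := ⌈n ^ 2⌉₊ * q with hN
  set k : ℕ := ⌈b * Real.log n⌉₊ with hk
  set K : ℕ := ⌈3 * Real.log n / Real.log 2⌉₊ with hK
  have hNδ : (N : ℝ) * (1 / q) = ⌈n ^ 2⌉₊ := by
    rw [hN]
    push_cast
    field_simp
  have hNlo : n ^ 2 ≤ N * (1 / (q : ℝ)) := hNδ ▸ Nat.le_ceil _
  have hNhi : N * (1 / (q : ℝ)) ≤ n ^ 2 + 1 := hNδ ▸ (Nat.ceil_lt_add_one (by positivity)).le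
  have hlog2 : 0 < Real.log 2 := Real.log_pos one_lt_two
  have hNK : (N : ℝ) * (1 / q) + 1 ≤ 2 ^ K := by
    have h1 : n ^ 2 + 2 ≤ n ^ 3 := by nlinarith
    have h2 : n ^ 3 ≤ 2 ^ K := by
      rw [← Real.log_le_log_iff (by positivity) (by positivity), Real.log_pow, Real.log_pow,
        ← div_le_iff₀ hlog2]
      exact_mod_cast Nat.le_ceil _
    linarith
  have hK6 : (K : ℝ) ≤ 6 * Real.log n := by
    have h1 := (Nat.ceil_lt_add_one (a := 3 * Real.log n / Real.log 2) (by positivity)).le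
    have h2 : 3 * Real.log n / Real.log 2 ≤ 5 * Real.log n := by
      rw [div_le_iff₀ hlog2]
      nlinarith [Real.log_two_gt_d9]
    rw [hK]
    linarith
  have hW : ∑ j : Fin N, (2 * ((j + 1) * (1 / (q : ℝ)) + 2)) ^ d *
      ν.real (markCell (1 / q) j) ≤ C₂ * Real.log n := by
    refine (sum_volume_mul_markCell_le htail (by positivity)
      (by rw [div_le_one hq']; exact_mod_cast hq) hNK).trans ?_
    calc (K : ℝ) * (8 ^ d * C) ≤ 6 * Real.log n * (8 ^ d * C) := by gcongr
      _ = C₂ * Real.log n := by rw [hC₂]; ring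
  have hkℓ : (k : ℝ) ≤ (b + 1) * Real.log n := by
    have := (Nat.ceil_lt_add_one (a := b * Real.log n) (by positivity)).le
    rw [hk]
    linarith
  have hmain := measureReal_not_shortThinnedConnections_le hX hν.nonneg (δ := 1 / q)
    (by positivity) N k hγ hkℓ
  have hpow : n ≤ n ^ d := by
    calc n = n ^ 1 := (pow_one n).symm
      _ ≤ n ^ d := pow_le_pow_right₀ (by linarith) (by omega)
  have h1 : n ^ d * ν.real (Set.Ici (N * (1 / (q : ℝ)))) ≤ C / n := by
    have ht := htail (N * (1 / q)) (by positivity)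
    rw [le_div_iff₀ hn0]
    refine le_trans ?_ ht
    rw [mul_right_comm, mul_comm]
    refine mul_le_mul_of_nonneg_left ?_ measureReal_nonneg
    calc n ^ d * n ≤ n ^ d * n ^ d := by gcongr
      _ = (n ^ 2) ^ d := by rw [← mul_pow, sq]
      _ ≤ _ := by gcongr; linarith
  have h2 : (n ^ d) ^ 2 * (1 / ((n ^ d) ^ 2 * n)) = 1 / n := by field_simp
  have h3 : n ^ d * Real.exp (-k + Real.exp 1 * ∑ j : Fin N,
      (2 * ((j + 1) * (1 / (q : ℝ)) + 2)) ^ d * ν.real (markCell (1 / q) j)) ≤ 1 / n := by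
    have hexp : -(k : ℝ) + Real.exp 1 * ∑ j : Fin N,
        (2 * ((j + 1) * (1 / (q : ℝ)) + 2)) ^ d * ν.real (markCell (1 / q) j) ≤
        -((d + 1 : ℕ) * Real.log n) := by
      have hk' : b * Real.log n ≤ k := Nat.le_ceil _
      have hW' := mul_le_mul_of_nonneg_left hW (Real.exp_nonneg 1)
      rw [hb] at hk'
      push_cast
      linarith
    calc _ ≤ n ^ d * Real.exp (-((d + 1 : ℕ) * Real.log n)) := by gcongr
      _ = 1 / n := by
        rw [Real.exp_neg, Real.exp_nat_mul, Real.exp_log hn0, pow_succ]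
        field_simp
  have hfin : P.real {ω | ¬ ShortThinnedConnections (X ω) ((b + 1) * Real.log n)} ≤ ε := by
    refine hmain.trans ?_
    rw [h2]
    calc _ ≤ C / n + 1 / n + 1 / n := by gcongr
      _ = (C + 2) / n := by ring
      _ ≤ ε := by rwa [div_le_comm₀ hn0 hε]
  exact (ENNReal.le_ofReal_iff_toReal_le (measure_ne_top _ _) hε.le).2 hfin
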